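/- For a category $\mathcal C$ let $\mathrm{add}(\mathcal C)$ be its additive hull, i.e. the category of formal finite direct sums of objects of the $\mathbb Z$-linearisation $\mathbb Z\mathcal C$ (morphisms are matrices with entries in $\mathbb Z\mathcal C$). For an additive category $\mathcal A$ let $\mathrm{mod}(\mathcal A)$ be the category obtained by adding formal cokernels: objects are morphisms $a\colon X_1\to X_0$ of $\mathcal A$, and morphisms from $a$ to $b\colon Y_1\to Y_0$ are commutative squares $(X_1\to Y_1,\,X_0\to Y_0)$ from $a$ to $b$, two squares being identified when the difference of their components $X_0\to Y_0$ factors through $b$ (equivalently, $\mathrm{mod}(\mathcal A)$ is the category of coherent functors $\mathcal A^{\mathrm{op}}\to\mathrm{Ab}$). The abelian hull of $\mathcal A$ is the abelian category $\mathrm{Ab}(\mathcal A)=\mathrm{mod}(\mathrm{mod}(\mathcal A)^{\mathrm{op}})^{\mathrm{op}}$. These constructions are functorial and there is a canonical functor $\mathcal C\to\mathrm{Ab}(\mathrm{add}(\mathcal C))$. Proposition. Let $\mathcal C$ be a category, $\Sigma$ a class of morphisms in $\mathcal C$, and $L\colon\mathcal C\to\mathcal C[\Sigma^{-1}]$ the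 localisation. Let $\mathcal S$ be the Serre subcategory of $\mathrm{Ab}(\mathrm{add}(\mathcal C))$ generated by the kernels and cokernels of the images in $\mathrm{Ab}(\mathrm{add}(\mathcal C))$ of the morphisms in $\Sigma$. Then the functor $$\mathrm{Ab}(\mathrm{add}(L))\colon \mathrm{Ab}(\mathrm{add}(\mathcal C))\longrightarrow\mathrm{Ab}(\mathrm{add}(\mathcal C[\Sigma^{-1}]))$$ induced by $L$ is exact, its composite with $\mathcal C\to\mathrm{Ab}(\mathrm{add}(\mathcal C))$ is naturally isomorphic to the composite of $L$ with $\mathcal C[\Sigma^{-1}]\to\mathrm{Ab}(\mathrm{add}(\mathcal C[\Sigma^{-1}]))$, it inverts every morphism whose kernel and cokernel lie in $\mathcal S$, and the functor which it induces on the quotient category $$\mathrm{Ab}(\mathrm{add}(\mathcal C))/\mathcal S\ \xrightarrow{\ \sim\ }\ \mathrm{Ab}(\mathrm{add}(\mathcal C[\Sigma^{-1}]))$$ is an equivalence. Here the quotient $\mathcal A/\mathcal S$ of an abelian category by a Serre subcategory is the localisation of $\mathcal A$ with respect to the morphisms with kernel and cokernel in $\mathcal S$. -/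

import Mathlib

open CategoryTheory CategoryTheory.Limits

universe v v' u u'

noncomputable section

namespace KrauseHull

/-! ### The additive hull `add(C)`: formal finite direct sums of objects of the `ℤ`-linearisation -/

section AdditiveHull

/-- The additive hull `add(C)` of a category `C`: its objects are finite families of objects of the
`ℤ`-linearisation `ℤC` (formal finite direct sums), its morphisms are matrices of morphisms
of `ℤC`. -/
abbrev AddHull (C : Type u) [Category.{v} C] : Type (max u 1) := Mat_ (Free ℤ C)

/-- The canonical functor `C ⥤ add(C)`. -/
def toAddHull (C : Type u) [Category.{v} C] : C ⥤ AddHull C :=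
  Free.embedding ℤ C ⋙ Mat_.embedding (Free ℤ C)

variable {C : Type u} [Category.{v} C] {D : Type u'} [Category.{v'} D]

/-- The functor `ℤC ⥤ ℤD` induced by a functor `F : C ⥤ D`, sending a formal
combination `∑ nᵢ fᵢ` to `∑ nᵢ F(fᵢ)`. -/
def freeMap (F : C ⥤ D) : Free ℤ C ⥤ Free ℤ D where
  obj X := F.obj X
  map {X Y} f := Finsupp.mapDomain (fun g : (show C from X) ⟶ (show C from Y) => F.map g) f
  map_id X := by
    refine (Finsupp.mapDomain_single (f := fun g : (show C from X) ⟶ (show C from X) => F.map g)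
      (a := 𝟙 (show C from X)) (b := (1 : ℤ))).trans ?_
    rw [F.map_id]
    rfl
  map_comp {X Y Z} f g := by
    induction f using Finsupp.induction_linear with
    | zero =>
      rw [zero_comp (X := X) (f := g)]
      erw [Finsupp.mapDomain_zero, Finsupp.mapDomain_zero, zero_comp]
    | add f₁ f₂ h₁ h₂ =>
      rw [Preadditive.add_comp (X) (Y) (Z)]
      erw [Finsupp.mapDomain_add, Finsupp.mapDomain_add, h₁, h₂, Preadditive.add_comp]
    | single f' r =>
      induction g using Finsupp.induction_linear with
      | zero =>
        erw [comp_zero, Finsupp.mapDomain_zero, Finsupp.mapDomain_zero, comp_zero]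
      | add g₁ g₂ h₁ h₂ =>
        rw [Preadditive.comp_add (X) (Y) (Z)]
        erw [Finsupp.mapDomain_add, Finsupp.mapDomain_add, h₁, h₂, Preadditive.comp_add]
      | single g' t =>
        refine (congrArg (Finsupp.mapDomain
          (fun g : (show C from X) ⟶ (show C from Z) => F.map g))
          (Free.single_comp_single ℤ C (X := (show C from X)) (Y := (show C from Y))
            (Z := (show C from Z)) f' g' r t)).trans ?_
        erw [Finsupp.mapDomain_single, Finsupp.mapDomain_single, Finsupp.mapDomain_single]
        refine Eq.trans ?_ (Free.single_comp_single ℤ D (F.map f') (F.map g') r t).symm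
        exact congrArg (fun p => Finsupp.single p (r * t)) (F.map_comp _ _)

instance (F : C ⥤ D) : (freeMap F).Additive where
  map_add := by
    intro X Y f g
    exact Finsupp.mapDomain_add

/-- The functor between categories of matrices which is induced by an additive functor. -/
def matMap {A : Type u} [Category.{v} A] [Preadditive A] {B : Type u'} [Category.{v'} B]
    [Preadditive B] (F : A ⥤ B) [F.Additive] : Mat_ A ⥤ Mat_ B where
  obj M := ⟨M.ι, fun i => F.obj (M.X i)⟩
  map f i j := F.map (f i j)
  map_id M := by
    apply Mat_.hom_ext
    intro i j
    by_cases h : i = j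
    · subst h
      exact ((congrArg F.map (Mat_.id_apply_self M i)).trans (F.map_id _)).trans
        (Mat_.id_apply_self (⟨M.ι, fun i => F.obj (M.X i)⟩ : Mat_ B) i).symm
    · exact ((congrArg F.map (Mat_.id_apply_of_ne M i j h)).trans (F.map_zero _ _)).trans
        (Mat_.id_apply_of_ne (⟨M.ι, fun i => F.obj (M.X i)⟩ : Mat_ B) i j h).symm
  map_comp {M N K} f g := by
    apply Mat_.hom_ext
    intro i j
    refine (F.map_sum (fun k : N.ι => f i k ≫ g k j) Finset.univ).trans ?_
    exact Finset.sum_congr rfl (fun k _ => F.map_comp _ _)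

instance {A : Type u} [Category.{v} A] [Preadditive A] {B : Type u'} [Category.{v'} B]
    [Preadditive B] (F : A ⥤ B) [F.Additive] : (matMap F).Additive where
  map_add := by
    intro M N f g
    apply Mat_.hom_ext
    intro i j
    exact F.map_add

/-- The additive functor `add(C) ⥤ add(D)` induced by a functor `F : C ⥤ D`. -/
def addHullMap (F : C ⥤ D) : AddHull C ⥤ AddHull D := matMap (freeMap F)

instance (F : C ⥤ D) : (addHullMap F).Additive :=
  inferInstanceAs (matMap (freeMap F)).Additive

end AdditiveHull

/-! ### The completion `mod(A)` under cokernels -/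

section Mod

/-- The category `mod(A)` obtained from an additive category `A` by adding formal cokernels: an
object is a morphism `a : X₁ ⟶ X₀` of `A` (standing for its cokernel), a morphism from `a` to `b`
is a commutative square, and two squares are identified if the difference of their components
`X₀ ⟶ Y₀` factors through `b`. It is the category of coherent functors `Aᵒᵖ ⥤ Ab`. -/
abbrev Mod (A : Type u) [Category.{v} A] [Preadditive A] : Type (max u v) :=
  Preadditive.RightFreyd A

variable {A : Type u} [Category.{v} A] [Preadditive A]
  {B : Type u'} [Category.{v'} B] [Preadditive B]

/-- The functor `mod(A) ⥤ mod(B)` induced by an additive functor `F : A ⥤ B`. -/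
def modMap (F : A ⥤ B) [F.Additive] : Mod A ⥤ Mod B :=
  CategoryTheory.Quotient.lift _ (F.mapArrow ⋙ Preadditive.RightFreyd.quotient B) (by
    rintro x y f g ⟨h⟩
    refine Preadditive.RightFreyd.eq_of_rightHomotopy _ _ ⟨F.map h.hom, ?_⟩
    exact (F.map_sub.symm.trans (congrArg F.map h.comm)).trans (F.map_comp _ _))

lemma modMap_map_quotient (F : A ⥤ B) [F.Additive] {x y : Arrow A} (f : x ⟶ y) :
    (modMap F).map ((Preadditive.RightFreyd.quotient A).map f) =
      (Preadditive.RightFreyd.quotient B).map (F.mapArrow.map f) := rfl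

instance (F : A ⥤ B) [F.Additive] : (modMap F).Additive where
  map_add := by
    intro X Y f g
    obtain ⟨x, rfl⟩ : ∃ a, X = (Preadditive.RightFreyd.quotient A).obj a := ⟨X.as, rfl⟩
    obtain ⟨y, rfl⟩ : ∃ a, Y = (Preadditive.RightFreyd.quotient A).obj a := ⟨Y.as, rfl⟩
    obtain ⟨f, rfl⟩ := (Preadditive.RightFreyd.quotient A).map_surjective f
    obtain ⟨g, rfl⟩ := (Preadditive.RightFreyd.quotient A).map_surjective g
    rw [← Functor.map_add, modMap_map_quotient, modMap_map_quotient, modMap_map_quotient]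
    refine Eq.trans ?_ ((Preadditive.RightFreyd.quotient B).map_add
      (f := F.mapArrow.map f) (g := F.mapArrow.map g))
    refine congrArg (Preadditive.RightFreyd.quotient B).map (Arrow.hom_ext _ _ ?_ ?_)
    · exact F.map_add
    · exact F.map_add

instance [HasFiniteBiproducts A] : HasFiniteBiproducts (Mod A) := by
  have : HasFiniteProducts A := inferInstance
  have : HasFiniteProducts (Arrow A) := ⟨fun n => inferInstance⟩
  have : HasFiniteBiproducts (Arrow A) := HasFiniteBiproducts.of_hasFiniteProducts
  refine ⟨fun n => ⟨fun f => ?_⟩⟩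
  exact (Preadditive.RightFreyd.quotient A).hasBiproduct_of_preserves
    (fun i => (f i).as)

end Mod

/-! ### `mod(A)` is abelian if `A` has kernels -/

section ModAbelian

open Preadditive.RightFreyd

attribute [local instance] hasBinaryBiproducts_of_finite_biproducts

variable {A : Type u} [Category.{v} A] [Preadditive A] [HasPullbacks A]

/-- The kernel of the morphism of `mod(A)` which is represented by a square `f`. -/
def kerObj {a b : Arrow A} (f : a ⟶ b) : Arrow A :=
  Arrow.mk (pullback.fst (pullback.fst f.right b.hom) a.hom)

/-- The inclusion of the kernel. -/
def kerι {a b : Arrow A} (f : a ⟶ b) : kerObj f ⟶ a :=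
  Arrow.homMk (pullback.snd (pullback.fst f.right b.hom) a.hom) (pullback.fst f.right b.hom)
    pullback.condition.symm

lemma mono_kerι {a b : Arrow A} (f : a ⟶ b) : Mono ((quotient A).map (kerι f)) := by
  rw [Preadditive.mono_iff_cancel_zero]
  intro w x hx
  obtain ⟨w, rfl⟩ : ∃ w', w = (quotient A).obj w' := ⟨w.as, rfl⟩
  obtain ⟨x, rfl⟩ := (quotient A).map_surjective x
  rw [← Functor.map_comp, quotient_map_eq_zero_iff] at hx
  obtain ⟨h, hh⟩ := hx
  have hh' : x.right ≫ pullback.fst f.right b.hom = h ≫ a.hom := (sub_zero _).symm.trans hh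
  rw [quotient_map_eq_zero_iff]
  exact ⟨⟨pullback.lift x.right h hh', (sub_zero _).trans (pullback.lift_fst _ _ _).symm⟩⟩

lemma kerι_comp {a b : Arrow A} (f : a ⟶ b) :
    (quotient A).map (kerι f) ≫ (quotient A).map f = 0 := by
  rw [← Functor.map_comp, quotient_map_eq_zero_iff]
  exact ⟨⟨pullback.snd f.right b.hom, (sub_zero _).trans pullback.condition⟩⟩

lemma exists_kerLift {a b w : Arrow A} (f : a ⟶ b) (g : w ⟶ a)
    (hg : (quotient A).map g ≫ (quotient A).map f = 0) :
    ∃ l : w ⟶ kerObj f, l ≫ kerι f = g := by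
  rw [← Functor.map_comp, quotient_map_eq_zero_iff] at hg
  obtain ⟨h, hh⟩ := hg
  have hh' : g.right ≫ f.right = h ≫ b.hom := (sub_zero _).symm.trans hh
  refine ⟨Arrow.homMk (pullback.lift (w.hom ≫ pullback.lift g.right h hh') g.left ?_)
    (pullback.lift g.right h hh') ?_, ?_⟩
  · rw [Category.assoc, pullback.lift_fst]
    exact (Arrow.w g).symm
  · exact pullback.lift_fst _ _ _
  · apply Arrow.hom_ext
    · exact pullback.lift_snd _ _ _
    · exact pullback.lift_fst _ _ _

instance modHasKernels : HasKernels (Mod A) where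
  has_limit {x y} f := ⟨by
    obtain ⟨x, rfl⟩ : ∃ a, x = (quotient A).obj a := ⟨x.as, rfl⟩
    obtain ⟨y, rfl⟩ : ∃ a, y = (quotient A).obj a := ⟨y.as, rfl⟩
    obtain ⟨f, rfl⟩ := (quotient A).map_surjective f
    have := mono_kerι f
    exact ⟨_, KernelFork.IsLimit.ofι' _ (kerι_comp f) (fun {w} g hg => Nonempty.some (by
      obtain ⟨w, rfl⟩ : ∃ a, w = (quotient A).obj a := ⟨w.as, rfl⟩
      obtain ⟨g, rfl⟩ := (quotient A).map_surjective g
      obtain ⟨l, hl⟩ := exists_kerLift f g hg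
      exact ⟨⟨(quotient A).map l, by rw [← Functor.map_comp, hl]⟩⟩))⟩⟩

variable [HasFiniteBiproducts A]

lemma mod_nonempty_normalMono {x y : Mod A} (f : x ⟶ y) [Mono f] : Nonempty (NormalMono f) := by
  obtain ⟨a, rfl⟩ : ∃ a, x = (quotient A).obj a := ⟨x.as, rfl⟩
  obtain ⟨b, rfl⟩ : ∃ a, y = (quotient A).obj a := ⟨y.as, rfl⟩
  obtain ⟨f, rfl⟩ := (quotient A).map_surjective f
  have h0 : (quotient A).map (kerι f) = 0 := by
    rw [← cancel_mono ((quotient A).map f), kerι_comp, zero_comp]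
  rw [quotient_map_eq_zero_iff] at h0
  obtain ⟨h, hh⟩ : ∃ h : pullback f.right b.hom ⟶ a.left,
      pullback.fst f.right b.hom = h ≫ a.hom :=
    ⟨h0.some.hom, (sub_zero _).symm.trans h0.some.comm⟩
  refine ⟨⟨_, (quotient A).map (Candidate.π f), (Candidate.cokernelCofork f).condition,
    KernelFork.IsLimit.ofι' _ _ (fun {w} g hg => Nonempty.some ?_)⟩⟩
  obtain ⟨w, rfl⟩ : ∃ a, w = (quotient A).obj a := ⟨w.as, rfl⟩
  obtain ⟨g, rfl⟩ := (quotient A).map_surjective g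
  rw [← Functor.map_comp, quotient_map_eq_zero_iff] at hg
  obtain ⟨k, hk⟩ := hg
  replace hk : g.right ≫ 𝟙 b.right = k ≫ biprod.desc b.hom f.right := (sub_zero _).symm.trans hk
  obtain ⟨k₁, k₂, rfl⟩ : ∃ (k₁ : w.right ⟶ b.left) (k₂ : w.right ⟶ a.right),
      k = biprod.lift k₁ k₂ :=
    ⟨k ≫ biprod.fst, k ≫ biprod.snd, by
      apply biprod.hom_ext <;> simp⟩
  rw [biprod.lift_desc, Category.comp_id] at hk
  have hw := Arrow.w g
  have e : (w.hom ≫ k₂) ≫ f.right = (g.left - w.hom ≫ k₁) ≫ b.hom := by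
    rw [Preadditive.sub_comp, Category.assoc, Category.assoc, hw, hk, Preadditive.comp_add]
    abel
  have hl : (pullback.lift _ _ e ≫ h) ≫ a.hom = w.hom ≫ k₂ := by
    rw [Category.assoc, ← hh, pullback.lift_fst]
  refine ⟨⟨(quotient A).map (Arrow.homMk (pullback.lift _ _ e ≫ h) k₂ hl), ?_⟩⟩
  rw [← Functor.map_comp]
  refine eq_of_rightHomotopy _ _ ⟨-k₁, ?_⟩
  change k₂ ≫ f.right - g.right = (-k₁) ≫ b.hom
  rw [hk, Preadditive.neg_comp]
  abel

lemma mod_nonempty_normalEpi {x y : Mod A} (f : x ⟶ y) [Epi f] : Nonempty (NormalEpi f) := by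
  obtain ⟨a, rfl⟩ : ∃ a, x = (quotient A).obj a := ⟨x.as, rfl⟩
  obtain ⟨b, rfl⟩ : ∃ a, y = (quotient A).obj a := ⟨y.as, rfl⟩
  obtain ⟨f, rfl⟩ := (quotient A).map_surjective f
  have h0 : (quotient A).map (Candidate.π f) = 0 := by
    rw [← cancel_epi ((quotient A).map f), comp_zero]
    exact (Candidate.cokernelCofork f).condition
  rw [quotient_map_eq_zero_iff] at h0
  obtain ⟨k, hk⟩ := h0
  replace hk : 𝟙 b.right = k ≫ biprod.desc b.hom f.right := (sub_zero _).symm.trans hk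
  obtain ⟨s, t, rfl⟩ : ∃ (s : b.right ⟶ b.left) (t : b.right ⟶ a.right), k = biprod.lift s t :=
    ⟨k ≫ biprod.fst, k ≫ biprod.snd, by
      apply biprod.hom_ext <;> simp⟩
  rw [biprod.lift_desc] at hk
  refine ⟨⟨_, (quotient A).map (kerι f), kerι_comp f,
    CokernelCofork.IsColimit.ofπ' _ _ (fun {w} g hg => Nonempty.some ?_)⟩⟩
  obtain ⟨w, rfl⟩ : ∃ a, w = (quotient A).obj a := ⟨w.as, rfl⟩
  obtain ⟨g, rfl⟩ := (quotient A).map_surjective g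
  rw [← Functor.map_comp, quotient_map_eq_zero_iff] at hg
  obtain ⟨h, hh⟩ : ∃ h : pullback f.right b.hom ⟶ w.left,
      pullback.fst f.right b.hom ≫ g.right = h ≫ w.hom :=
    ⟨hg.some.hom, (sub_zero _).symm.trans hg.some.comm⟩
  have e : (b.hom ≫ t) ≫ f.right = (𝟙 _ - b.hom ≫ s) ≫ b.hom := by
    have := b.hom ≫= hk
    rw [Category.comp_id, Preadditive.comp_add] at this
    rw [Preadditive.sub_comp, Category.id_comp, Category.assoc, Category.assoc]
    exact eq_sub_of_add_eq' this.symm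
  have hl : (pullback.lift _ _ e ≫ h) ≫ w.hom = b.hom ≫ t ≫ g.right := by
    rw [Category.assoc, ← hh, pullback.lift_fst_assoc, Category.assoc]
  have e' : (f.right ≫ t - 𝟙 _) ≫ f.right = (-(f.right ≫ s)) ≫ b.hom := by
    have := f.right ≫= hk
    rw [Category.comp_id, Preadditive.comp_add] at this
    rw [Preadditive.sub_comp, Category.id_comp, Preadditive.neg_comp, Category.assoc,
      Category.assoc, sub_eq_iff_eq_add, eq_neg_add_iff_add_eq]
    exact this.symm
  refine ⟨⟨(quotient A).map (Arrow.homMk (pullback.lift _ _ e ≫ h) (t ≫ g.right) hl), ?_⟩⟩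
  rw [← Functor.map_comp]
  refine eq_of_rightHomotopy _ _ ⟨pullback.lift _ _ e' ≫ h, ?_⟩
  change f.right ≫ t ≫ g.right - g.right = (pullback.lift _ _ e' ≫ h) ≫ w.hom
  rw [Category.assoc, ← hh, pullback.lift_fst_assoc, Preadditive.sub_comp, Category.id_comp,
    Category.assoc]

/-- If the additive category `A` has pullbacks (equivalently, kernels), then `mod(A)` is
abelian. -/
instance modAbelian : Abelian (Mod A) where
  normalMonoOfMono f _ := mod_nonempty_normalMono f
  normalEpiOfEpi f _ := mod_nonempty_normalEpi f

end ModAbelian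

/-! ### The abelian hull of an additive category -/

section AbHull

/-- The abelian hull `Ab(A) = (mod((mod A)ᵒᵖ))ᵒᵖ` of an additive category `A`. -/
abbrev AbHull (A : Type u) [Category.{v} A] [Preadditive A] : Type (max u v) :=
  (Mod (Mod A)ᵒᵖ)ᵒᵖ

instance (A : Type u) [Category.{v} A] [Preadditive A] [HasFiniteBiproducts A] :
    HasPullbacks (Mod A)ᵒᵖ := by
  have := hasBinaryBiproducts_of_finite_biproducts A
  have : HasCoequalizers (Mod A) := Preadditive.hasCoequalizers_of_hasCokernels
  have : HasFiniteProducts (Mod A)ᵒᵖ := inferInstance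
  exact hasPullbacks_of_hasBinaryProducts_of_hasEqualizers _

instance (A : Type u) [Category.{v} A] [Preadditive A] [HasFiniteBiproducts A] :
    HasFiniteBiproducts (Mod A)ᵒᵖ :=
  HasFiniteBiproducts.of_hasFiniteProducts

/-- The canonical functor `A ⥤ Ab(A)`, the composite of `A ⥤ mod(A)` and
`mod(A) ⥤ (mod(mod(A)ᵒᵖ))ᵒᵖ`. -/
def toAbHull (A : Type u) [Category.{v} A] [Preadditive A] [HasFiniteBiproducts A] :
    A ⥤ AbHull A :=
  Preadditive.RightFreyd.functor A ⋙ (Preadditive.RightFreyd.functor (Mod A)ᵒᵖ).rightOp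

/-- The functor `Ab(A) ⥤ Ab(B)` induced by an additive functor `A ⥤ B`. -/
def abHullMap {A : Type u} [Category.{v} A] [Preadditive A]
    {B : Type u'} [Category.{v'} B] [Preadditive B] (F : A ⥤ B) [F.Additive] :
    AbHull A ⥤ AbHull B :=
  (modMap (modMap F).op).op

end AbHull

/-! ### Serre subcategories -/

section Serre

variable {A : Type u} [Category.{v} A] [Abelian A]

/-- The Serre subcategory generated by a class `P` of objects of an abelian category: the
intersection of all Serre subcategories which contain `P`. -/
def serreClosure (P : ObjectProperty A) : ObjectProperty A :=
  fun X => ∀ Q : ObjectProperty A, Q.IsSerreClass → P ≤ Q → Q X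

instance (P : ObjectProperty A) : (serreClosure P).IsSerreClass where
  exists_zero := by
    obtain ⟨Z, hZ⟩ := HasZeroObject.zero (C := A)
    exact ⟨Z, hZ, fun Q _ _ => Q.prop_of_isZero hZ⟩
  prop_of_mono f _ hY := fun Q hQ hP => Q.prop_of_mono f (hY Q hQ hP)
  prop_of_epi f _ hX := fun Q hQ hP => Q.prop_of_epi f (hX Q hQ hP)
  prop_X₂_of_shortExact hS h₁ h₃ := fun Q hQ hP =>
    Q.prop_X₂_of_shortExact hS (h₁ Q hQ hP) (h₃ Q hQ hP)

/-- The kernels and cokernels of the images under `F` of the morphisms in `W`. -/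
inductive KerCoker {C : Type u'} [Category.{v'} C] (F : C ⥤ A) (W : MorphismProperty C) :
    ObjectProperty A
  | ker {X Y : C} (f : X ⟶ Y) (hf : W f) : KerCoker F W (kernel (F.map f))
  | coker {X Y : C} (f : X ⟶ Y) (hf : W f) : KerCoker F W (cokernel (F.map f))

end Serre

section Main

/-- The canonical functor `C ⥤ Ab(add(C))`. -/
def toAbAdd (C : Type u) [Category.{v} C] : C ⥤ AbHull (AddHull C) :=
  toAddHull C ⋙ toAbHull (AddHull C)

/-- The functor `Ab(add(C)) ⥤ Ab(add(D))` induced by a functor `C ⥤ D`. -/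
def abAddMap {C : Type u} [Category.{v} C] {D : Type u'} [Category.{v'} D] (F : C ⥤ D) :
    AbHull (AddHull C) ⥤ AbHull (AddHull D) :=
  abHullMap (addHullMap F)

/-- The Serre subcategory of `Ab(add(C))` generated by the kernels and cokernels of the
morphisms in `W`, viewed as morphisms in `Ab(add(C))`. -/
def serreOf {C : Type u} [Category.{v} C] (W : MorphismProperty C) :
    ObjectProperty (AbHull (AddHull C)) :=
  serreClosure (KerCoker (toAbAdd C) W)

instance {C : Type u} [Category.{v} C] (W : MorphismProperty C) : (serreOf W).IsSerreClass :=
  inferInstanceAs (serreClosure (KerCoker (toAbAdd C) W)).IsSerreClass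

/-- The quotient category `A/S` of an abelian category by a Serre subcategory: the localisation
of `A` with respect to the morphisms whose kernel and cokernel belong to `S`. -/
abbrev SerreQuotient {A : Type u} [Category.{v} A] [Abelian A] (S : ObjectProperty A)
    [S.IsSerreClass] : Type u :=
  S.isoModSerre.Localization

end Main

end KrauseHull

end

/-! Both categories have the same universal property. Exact functors from `Ab(add(C))` to an abelian
category `B` correspond, by restriction along `toAbAdd C`, to arbitrary functors `C ⥤ B`:
`abAddLift` gives existence and `abAddExt` uniqueness up to isomorphism. An exact functor kills the
kernel and the cokernel of a morphism exactly when it inverts that morphism. So exact functors on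
the quotient by `S` are functors on `C` inverting `W`, hence functors on `D`, hence exact functors
on `Ab(add(D))`. The quasi-inverse is the exact extension of the functor from `D` to the quotient
induced by `toAbAdd C ⋙ Q`.

The universal property is built in layers: `ℤC`, matrices, then `mod` twice. Every object of
`mod(A)` is the cokernel of a morphism of `A`, so functors respecting these cokernels
(`PreservesPresentations`) are right exact and are determined by their restriction to `A`
(`modExt`). The decisive point is `PreservesPresentations.preservesFiniteLimits`: if `A` has
pullbacks and the restriction to `A` is left exact, the functor on `mod(A)` is exact. The inner
`mod` produces a right exact functor; its opposite is left exact on `mod(A)ᵒᵖ`, so the outer `mod`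
produces an exact one. -/

noncomputable section

namespace KrauseHull

/-! ### Additive functors on `ℤC`. -/

section FreeExtension

variable {C : Type u} [Category.{v} C] {B : Type u'} [Category.{v'} B] [Preadditive B]

/-- The additive map which sends a formal combination `∑ nᵢ fᵢ` to `∑ nᵢ F(fᵢ)`. -/
def freeLiftHom (F : C ⥤ B) (X Y : C) : ((X ⟶ Y) →₀ ℤ) →+ (F.obj X ⟶ F.obj Y) :=
  Finsupp.liftAddHom fun f => zmultiplesHom _ (F.map f)

lemma freeLiftHom_single (F : C ⥤ B) {X Y : C} (f : X ⟶ Y) (r : ℤ) :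
    freeLiftHom F X Y (Finsupp.single f r) = r • F.map f :=
  Finsupp.liftAddHom_apply_single _ _ _

lemma freeLiftHom_apply (F : C ⥤ B) {X Y : C} (f : (X ⟶ Y) →₀ ℤ) :
    freeLiftHom F X Y f = ∑ g ∈ f.support, f g • F.map g :=
  Finsupp.liftAddHom_apply _ _

lemma freeLiftHom_comp (F : C ⥤ B) {X Y Z : C} (f : (X ⟶ Y) →₀ ℤ) (g : (Y ⟶ Z) →₀ ℤ) :
    freeLiftHom F X Z (f.sum fun f' s => g.sum fun g' t => Finsupp.single (f' ≫ g') (s * t)) =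
      freeLiftHom F X Y f ≫ freeLiftHom F Y Z g := by
  rw [freeLiftHom_apply F f, freeLiftHom_apply F g]
  simp only [Finsupp.sum, map_sum, freeLiftHom_single, Preadditive.sum_comp, Preadditive.comp_sum,
    F.map_comp, Preadditive.zsmul_comp, Preadditive.comp_zsmul, mul_smul, Finset.smul_sum]
  rw [Finset.sum_comm]
  simp only [smul_comm (f _)]

/-- The additive functor `ℤC ⥤ B` which extends a functor from `C` to a preadditive category `B`. -/
def freeLift (F : C ⥤ B) : Free ℤ C ⥤ B where
  obj X := F.obj X
  map {X Y} f := freeLiftHom F X Y f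
  map_id X := (freeLiftHom_single F (𝟙 (show C from X)) 1).trans
    ((one_smul ℤ _).trans (F.map_id _))
  map_comp f g := freeLiftHom_comp F f g

instance (F : C ⥤ B) : (freeLift F).Additive where
  map_add {X Y f g} := map_add (freeLiftHom F X Y) f g

/-- The functor `freeLift F` extends `F`. -/
def freeLiftIso (F : C ⥤ B) : Free.embedding ℤ C ⋙ freeLift F ≅ F :=
  NatIso.ofComponents (fun X => Iso.refl (F.obj X)) (fun {X Y} f => by
    refine (Category.comp_id (freeLiftHom F X Y (Finsupp.single f 1))).trans
      (Eq.trans ?_ (Category.id_comp (F.map f)).symm)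
    exact (freeLiftHom_single F f 1).trans (one_smul ℤ _))

/-- Two additive functors on `ℤC` are isomorphic if their restrictions to `C` are. -/
def freeExt {F G : Free ℤ C ⥤ B} [F.Additive] [G.Additive]
    (α : Free.embedding ℤ C ⋙ F ≅ Free.embedding ℤ C ⋙ G) : F ≅ G :=
  NatIso.ofComponents (fun X => α.app X) (fun {X Y} f => by
    let a (X : Free ℤ C) : F.obj X ⟶ G.obj X := α.hom.app X
    -- Both sides of the naturality square are additive in `f`, so integer multiples of single
    -- morphisms of `C` suffice.
    refine DFunLike.congr_fun (Finsupp.addHom_ext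
      (f := (Preadditive.rightComp (F.obj X) (a Y)).comp (F.mapAddHom (X := X) (Y := Y)))
      (g := (Preadditive.leftComp (G.obj Y) (a X)).comp (G.mapAddHom (X := X) (Y := Y)))
      fun f' r => ?_) f
    let f₁ : X ⟶ Y := (Free.embedding ℤ C).map f'
    have e : (Finsupp.single f' r : X ⟶ Y) = r • f₁ :=
      (Finsupp.smul_single_one f' r).symm
    refine (congrArg (fun f => F.map f ≫ a Y) e).trans ?_
    refine Eq.trans ?_ (congrArg (fun f => a X ≫ G.map f) e).symm
    rw [F.map_zsmul, G.map_zsmul, Preadditive.zsmul_comp, Preadditive.comp_zsmul]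
    exact congrArg (fun h => r • h) (α.hom.naturality f'))

end FreeExtension

/-! ### Additive functors on categories of matrices. -/

section MatExtension

variable {A : Type u} [Category.{v} A] [Preadditive A]
  {B : Type u'} [Category.{v'} B] [Preadditive B]

open scoped Classical in
/-- The projection of an object of `Mat_ A` to one of its summands. -/
def matπ (M : Mat_ A) (i : M.ι) : M ⟶ (Mat_.embedding A).obj (M.X i) :=
  fun j _ => if h : j = i then eqToHom (congrArg M.X h) else 0

open scoped Classical in
/-- The inclusion of a summand of an object of `Mat_ A`. -/
def matι (M : Mat_ A) (i : M.ι) : (Mat_.embedding A).obj (M.X i) ⟶ M :=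
  fun _ j => if h : i = j then eqToHom (congrArg M.X h) else 0

lemma comp_matπ_apply {M N : Mat_ A} (f : M ⟶ N) (i : M.ι) (j : N.ι) :
    (f ≫ matπ N j) i PUnit.unit = f i j := by
  refine (Mat_.comp_apply f (matπ N j) i PUnit.unit).trans ?_
  rw [Finset.sum_eq_single j]
  · simp only [matπ, dif_pos]
    exact Category.comp_id _
  · intro k _ hk
    simp [matπ, hk]
  · simp

lemma matι_comp_apply {M N : Mat_ A} (f : M ⟶ N) (i : M.ι) (j : N.ι) :
    (matι M i ≫ f) PUnit.unit j = f i j := by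
  refine (Mat_.comp_apply (matι M i) f PUnit.unit j).trans ?_
  rw [Finset.sum_eq_single i]
  · simp only [matι, dif_pos]
    exact Category.id_comp _
  · intro k _ hk
    simp [matι, hk.symm]
  · simp

lemma matι_comp_matπ {M N : Mat_ A} (f : M ⟶ N) (i : M.ι) (j : N.ι) :
    matι M i ≫ f ≫ matπ N j = (Mat_.embedding A).map (f i j) := by
  apply Mat_.hom_ext
  rintro ⟨⟩ ⟨⟩
  exact (matι_comp_apply (f ≫ matπ N j) i PUnit.unit).trans (comp_matπ_apply f i j)

lemma matι_matπ_self (M : Mat_ A) (i : M.ι) : matι M i ≫ matπ M i = 𝟙 _ := by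
  have := matι_comp_matπ (𝟙 M) i i
  rwa [Category.id_comp, Mat_.id_apply_self, CategoryTheory.Functor.map_id] at this

lemma matι_matπ_of_ne (M : Mat_ A) {i j : M.ι} (h : i ≠ j) : matι M i ≫ matπ M j = 0 := by
  have := matι_comp_matπ (𝟙 M) i j
  rwa [Category.id_comp, Mat_.id_apply_of_ne M i j h, Functor.map_zero] at this

/-- With the two orthogonality relations above, this exhibits `M` as the biproduct of its entries,
so that natural transformations between additive functors can be glued from their values on `A`. -/
lemma sum_matπ_matι (M : Mat_ A) : ∑ i, matπ M i ≫ matι M i = 𝟙 M := by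
  apply Mat_.hom_ext
  intro j k
  have h (s : Finset M.ι) (f : M.ι → (M ⟶ M)) : (∑ i ∈ s, f i) j k = ∑ i ∈ s, f i j k := by
    classical
    induction s using Finset.induction_on with
    | empty => rfl
    | insert i s hi hs => rw [Finset.sum_insert hi, Finset.sum_insert hi, Mat_.add_apply, hs]
  rw [h]
  have h' (i : M.ι) : (matπ M i ≫ matι M i) j k = matπ M i j PUnit.unit ≫ matι M i PUnit.unit k :=
    (Mat_.comp_apply (matπ M i) (matι M i) j k).trans (Fintype.sum_unique (ι := PUnit) _)
  simp only [h']
  rw [Finset.sum_eq_single j]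
  · by_cases hk : j = k
    · subst hk
      simp only [matι, matπ, dif_pos, Mat_.id_apply_self]
      exact Category.id_comp _
    · simp [matι, hk]
  · intro i _ hi
    simp [matπ, hi.symm]
  · simp

lemma comp_matπ {M N : Mat_ A} (f : M ⟶ N) (j : N.ι) :
    f ≫ matπ N j = ∑ i, matπ M i ≫ (Mat_.embedding A).map (f i j) := by
  simp only [← matι_comp_matπ, ← Category.assoc]
  rw [← Preadditive.sum_comp, ← Preadditive.sum_comp, sum_matπ_matι, Category.id_comp]

lemma matι_comp {M N : Mat_ A} (f : M ⟶ N) (i : M.ι) :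
    matι M i ≫ f = ∑ j, (Mat_.embedding A).map (f i j) ≫ matι N j := by
  simp only [← matι_comp_matπ, Category.assoc]
  rw [← Preadditive.comp_sum, ← Preadditive.comp_sum, sum_matπ_matι, Category.comp_id]

/-- The natural transformation between additive functors on `Mat_ A` which extends one
between the restrictions to `A`. -/
def matExtHom {F G : Mat_ A ⥤ B} [F.Additive] [G.Additive]
    (α : Mat_.embedding A ⋙ F ⟶ Mat_.embedding A ⋙ G) : F ⟶ G where
  app M := ∑ i, F.map (matπ M i) ≫ α.app (M.X i) ≫ G.map (matι M i)
  naturality M N f := by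
    have h (i j) : F.map ((Mat_.embedding A).map (f i j)) ≫ α.app (N.X j) =
      α.app (M.X i) ≫ G.map ((Mat_.embedding A).map (f i j)) := α.naturality (f i j)
    simp only [Preadditive.comp_sum, Preadditive.sum_comp, ← F.map_comp_assoc, comp_matπ,
      Category.assoc, ← G.map_comp, matι_comp, F.map_sum, G.map_sum]
    rw [Finset.sum_comm]
    simp only [F.map_comp, G.map_comp, Category.assoc, reassoc_of% h]

/-- The cross terms of the double sum vanish because distinct summands are orthogonal. Functoriality
in `α` is what turns an isomorphism on `A` into one on `Mat_ A`. -/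
lemma matExtHom_comp {F G H : Mat_ A ⥤ B} [F.Additive] [G.Additive] [H.Additive]
    (α : Mat_.embedding A ⋙ F ⟶ Mat_.embedding A ⋙ G)
    (β : Mat_.embedding A ⋙ G ⟶ Mat_.embedding A ⋙ H) :
    matExtHom α ≫ matExtHom β = matExtHom (α ≫ β) := by
  ext M
  have h (i j : M.ι) (hij : j ≠ i) : G.map (matι M i) ≫ G.map (matπ M j) = 0 := by
    rw [← G.map_comp, matι_matπ_of_ne M hij.symm, G.map_zero]
  have h' (i : M.ι) : G.map (matι M i) ≫ G.map (matπ M i) = 𝟙 _ := by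
    rw [← G.map_comp, matι_matπ_self, G.map_id]
  simp only [matExtHom, NatTrans.comp_app, Preadditive.comp_sum, Preadditive.sum_comp,
    Category.assoc]
  refine Finset.sum_congr rfl fun i _ => ?_
  rw [Finset.sum_eq_single i]
  · rw [reassoc_of% (h' i)]
  · intro j _ hj
    rw [reassoc_of% (h j i hj.symm)]
    simp
  · simp

lemma matExtHom_id (F : Mat_ A ⥤ B) [F.Additive] : matExtHom (𝟙 (Mat_.embedding A ⋙ F)) = 𝟙 F := by
  ext M
  simp only [matExtHom, NatTrans.id_app]
  rw [← F.map_id, ← sum_matπ_matι M, F.map_sum]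
  refine Finset.sum_congr rfl fun i _ => ?_
  rw [F.map_comp]
  exact congrArg _ (Category.id_comp _)

/-- Two additive functors on `Mat_ A` are isomorphic if their restrictions to `A` are. -/
def matExt {F G : Mat_ A ⥤ B} [F.Additive] [G.Additive]
    (α : Mat_.embedding A ⋙ F ≅ Mat_.embedding A ⋙ G) : F ≅ G where
  hom := matExtHom α.hom
  inv := matExtHom α.inv
  hom_inv_id := by rw [matExtHom_comp, α.hom_inv_id, matExtHom_id]
  inv_hom_id := by rw [matExtHom_comp, α.inv_hom_id, matExtHom_id]

variable [HasFiniteBiproducts B]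

/-- The additive functor `Mat_ A ⥤ B` which extends an additive functor `A ⥤ B`. -/
def matLift (F : A ⥤ B) [F.Additive] : Mat_ A ⥤ B where
  obj M := ⨁ fun i => F.obj (M.X i)
  map f := biproduct.matrix fun i j => F.map (f i j)
  map_id M := by
    ext i j
    by_cases h : j = i
    · subst h; simp
    · simp [h]
  map_comp f g := by
    ext i j
    simp [biproduct.lift_desc]

instance (F : A ⥤ B) [F.Additive] : (matLift F).Additive where
  map_add {M N f g} := by
    refine Eq.trans (congrArg biproduct.matrix (funext₂ fun i j => F.map_add)) ?_
    change _ = biproduct.matrix (fun i j => F.map (f i j)) +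
      biproduct.matrix (fun i j => F.map (g i j))
    ext i j
    simp

/-- The functor `matLift F` extends `F`. -/
def matLiftIso (F : A ⥤ B) [F.Additive] : Mat_.embedding A ⋙ matLift F ≅ F :=
  NatIso.ofComponents (fun X =>
    { hom := biproduct.π (fun _ : PUnit => F.obj X) PUnit.unit
      inv := biproduct.ι (fun _ : PUnit => F.obj X) PUnit.unit
      hom_inv_id := biproduct.hom_ext' _ _ fun i => by
        obtain rfl := Subsingleton.elim (α := PUnit) i PUnit.unit
        exact (biproduct.ι_π_self_assoc _ _ _).trans (Category.comp_id _).symm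
      inv_hom_id := biproduct.ι_π_self _ _ })
    (fun {X Y} f => by
      refine biproduct.hom_ext' _ _ fun i => ?_
      obtain rfl := Subsingleton.elim (α := PUnit) i PUnit.unit
      refine (biproduct.ι_matrix_assoc _ _ _).trans ((biproduct.lift_π _ _).trans ?_)
      exact (biproduct.ι_π_self_assoc (fun _ : PUnit => F.obj X) _ _).symm)

end MatExtension

/-! ### The universal property of `add(C)`. -/

section AddHullExtension

variable {C : Type u} [Category.{v} C] {B : Type u'} [Category.{v'} B]

/-- The functor `addHullMap F` extends `F`. -/
def toAddHullCompMapIso (F : C ⥤ B) : toAddHull C ⋙ addHullMap F ≅ F ⋙ toAddHull B :=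
  NatIso.ofComponents (fun X => Iso.refl ((toAddHull B).obj (F.obj X))) (fun {X Y} f => by
    refine (Category.comp_id _).trans (Eq.trans ?_ (Category.id_comp _).symm)
    exact congrArg (Mat_.embedding (Free ℤ B)).map
      (Finsupp.mapDomain_single (f := fun g : X ⟶ Y => F.map g) (a := f) (b := (1 : ℤ))))

variable [Preadditive B]

/-- Two additive functors on `add(C)` are isomorphic if their restrictions to `C` are. -/
def addHullExt {F G : AddHull C ⥤ B} [F.Additive] [G.Additive]
    (α : toAddHull C ⋙ F ≅ toAddHull C ⋙ G) : F ≅ G :=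
  matExt (freeExt (F := Mat_.embedding _ ⋙ F) (G := Mat_.embedding _ ⋙ G) α)

variable [HasFiniteBiproducts B]

/-- The additive functor `add(C) ⥤ B` which extends a functor `C ⥤ B`. -/
def addHullLift (F : C ⥤ B) : AddHull C ⥤ B := matLift (freeLift F)

instance (F : C ⥤ B) : (addHullLift F).Additive :=
  inferInstanceAs (matLift (freeLift F)).Additive

/-- The functor `addHullLift F` extends `F`. -/
def addHullLiftIso (F : C ⥤ B) : toAddHull C ⋙ addHullLift F ≅ F :=
  Functor.isoWhiskerLeft (Free.embedding ℤ C) (matLiftIso (freeLift F)) ≪≫ freeLiftIso F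

end AddHullExtension

/-! ### Presentations in `mod(A)` and right exactness. -/

section Presentation

open Preadditive.RightFreyd ZeroObject

variable {A : Type u} [Category.{v} A] [Preadditive A] [HasZeroObject A]
  {B : Type u'} [Category.{v'} B]

/-- The canonical epimorphism from `a.right` to the formal cokernel of `a`. -/
def modπ (a : Arrow A) : (functor A).obj a.right ⟶ (quotient A).obj a :=
  (quotient A).map (Arrow.homMk 0 (𝟙 a.right) (zero_comp.trans zero_comp.symm))

lemma functor_map_modπ (a : Arrow A) : (functor A).map a.hom ≫ modπ a = 0 := by
  refine ((quotient A).map_comp _ _).symm.trans ?_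
  rw [quotient_map_eq_zero_iff]
  refine ⟨⟨𝟙 a.left, ?_⟩⟩
  change a.hom ≫ 𝟙 a.right - 0 = 𝟙 a.left ≫ a.hom
  simp

lemma modπ_naturality {a b : Arrow A} (f : a ⟶ b) :
    (functor A).map f.right ≫ modπ b = modπ a ≫ (quotient A).map f := by
  refine ((quotient A).map_comp _ _).symm.trans (Eq.trans ?_ ((quotient A).map_comp _ _))
  refine congrArg _ (Arrow.hom_ext _ _ ?_ ?_)
  · exact (isZero_zero A).eq_of_src _ _
  · exact (Category.comp_id _).trans (Category.id_comp _).symm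

instance epi_modπ (a : Arrow A) : Epi (modπ a) := by
  have : IsIso ((Arrow.homMk 0 (𝟙 a.right) (zero_comp.trans zero_comp.symm) :
    (rightFunctor A).obj a.right ⟶ a).right) := by
    change IsIso (𝟙 a.right)
    infer_instance
  exact epi_of_isIso_right _

/-- A homotopy showing that `k` kills `a.hom` is exactly the left component needed to complete
`k.right` to a square. Together with `epi_modπ`, this makes `modπ a` a cokernel of `a.hom` in
`mod(A)`. -/
lemma exists_modπ_desc (a : Arrow A) {Z : Mod A} (k : (functor A).obj a.right ⟶ Z)
    (hk : (functor A).map a.hom ≫ k = 0) : ∃ l, modπ a ≫ l = k := by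
  obtain ⟨w, rfl⟩ : ∃ w, Z = (quotient A).obj w := ⟨Z.as, rfl⟩
  obtain ⟨k, rfl⟩ := (quotient A).map_surjective k
  replace hk := ((quotient A).map_comp _ _).trans hk
  rw [quotient_map_eq_zero_iff] at hk
  obtain ⟨h, hh⟩ := hk
  refine ⟨(quotient A).map (Arrow.homMk h k.right (hh.symm.trans (sub_zero _))), ?_⟩
  refine ((quotient A).map_comp _ _).symm.trans (congrArg _ (Arrow.hom_ext _ _ ?_ ?_))
  · exact (isZero_zero A).eq_of_src _ _
  · exact Category.id_comp _

variable [Preadditive B]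

/-- The functor `G` on `mod(A)` preserves the presentations of the objects of `mod(A)` as
cokernels of morphisms of `A`. -/
structure PreservesPresentations (G : Mod A ⥤ B) : Prop where
  epi (a : Arrow A) : Epi (G.map (modπ a))
  exists_desc (a : Arrow A) {Z : B} (k : G.obj ((functor A).obj a.right) ⟶ Z)
    (hk : G.map ((functor A).map a.hom) ≫ k = 0) : ∃ l, G.map (modπ a) ≫ l = k

lemma map_functor_map_modπ (G : Mod A ⥤ B) [G.Additive] (a : Arrow A) :
    G.map ((functor A).map a.hom) ≫ G.map (modπ a) = 0 := by
  rw [← G.map_comp, functor_map_modπ, G.map_zero]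

lemma PreservesPresentations.of_preservesCokernels (G : Mod A ⥤ B) [G.Additive]
    [∀ {X Y : Mod A} (f : X ⟶ Y), PreservesColimit (parallelPair f 0) G] :
    PreservesPresentations G where
  epi a := by
    have h := CokernelCofork.IsColimit.ofπ' (modπ a) (functor_map_modπ a)
      (fun k hk => ⟨(exists_modπ_desc a k hk).choose, (exists_modπ_desc a k hk).choose_spec⟩)
    exact Cofork.IsColimit.epi (CokernelCofork.mapIsColimit _ h G)
  exists_desc a Z k hk := by
    have h := CokernelCofork.IsColimit.ofπ' (modπ a) (functor_map_modπ a)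
      (fun k hk => ⟨(exists_modπ_desc a k hk).choose, (exists_modπ_desc a k hk).choose_spec⟩)
    exact ⟨_, (CokernelCofork.IsColimit.desc' (CokernelCofork.mapIsColimit _ h G) k hk).2⟩

namespace PreservesPresentations

variable {G : Mod A ⥤ B} (hG : PreservesPresentations G)

include hG

/-- The cokernel of a square `f : a ⟶ b` is presented by the arrow from `b.left ⊞ a.right` to
`b.right` with components `b.hom` and `f.right`. A morphism out of `G(b)` that kills `G(f)`,
precomposed with `G(modπ b)`, vanishes on both components and hence descends. -/
lemma preservesCokernel [HasBinaryBiproducts A] [G.Additive] {X Y : Mod A} (f : X ⟶ Y) :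
    PreservesColimit (parallelPair f 0) G := by
  obtain ⟨a, rfl⟩ : ∃ a, X = (quotient A).obj a := ⟨X.as, rfl⟩
  obtain ⟨b, rfl⟩ : ∃ a, Y = (quotient A).obj a := ⟨Y.as, rfl⟩
  obtain ⟨f, rfl⟩ := (quotient A).map_surjective f
  have hπ : G.map (modπ b) ≫ G.map ((quotient A).map (Candidate.π f)) =
      G.map (modπ (Candidate.cokernel f)) := by
    rw [← G.map_comp, ← modπ_naturality]
    exact congrArg G.map ((congrArg (· ≫ _) ((functor A).map_id _)).trans (Category.id_comp _))
  have := hG.epi b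
  have := hG.epi (Candidate.cokernel f)
  have : Epi (G.map (Cofork.π (Candidate.cokernelCofork f))) := by
    change Epi (G.map ((quotient A).map (Candidate.π f)))
    rw [← hπ] at this
    exact epi_of_epi (G.map (modπ b)) _
  refine preservesColimit_of_preserves_colimit_cocone (Candidate.isColimitCokernelCofork f)
    ((CokernelCofork.isColimitMapCoconeEquiv _ G).symm
      (CokernelCofork.IsColimit.ofπ' _ (by
        rw [← G.map_comp, CokernelCofork.condition, G.map_zero]) fun {Z} k hk => Nonempty.some ?_))
  have e₁ : G.map ((functor A).map b.hom) ≫ G.map (modπ b) ≫ k = 0 := by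
    rw [← Category.assoc, map_functor_map_modπ, zero_comp]
  have e₂ : G.map ((functor A).map f.right) ≫ G.map (modπ b) ≫ k = 0 := by
    rw [← G.map_comp_assoc, modπ_naturality, G.map_comp, Category.assoc]
    exact (congrArg (_ ≫ ·) hk).trans comp_zero
  obtain ⟨l, hl⟩ := hG.exists_desc (Candidate.cokernel f) (G.map (modπ b) ≫ k) (by
    have : (Candidate.cokernel f).hom = biprod.fst ≫ b.hom + biprod.snd ≫ f.right := by
      apply biprod.hom_ext' <;> simp
    rw [this, Functor.map_add, Functor.map_add, Preadditive.add_comp]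
    rw [Functor.map_comp, Functor.map_comp, Functor.map_comp, Functor.map_comp, Category.assoc,
      Category.assoc, e₁, e₂, comp_zero, comp_zero, add_zero])
  refine ⟨⟨l, ?_⟩⟩
  rw [← cancel_epi (G.map (modπ b)), ← hl, ← hπ, Category.assoc]
  rfl

end PreservesPresentations

end Presentation

/-! ### Left exactness of the embedding of `A` into `mod(A)`. -/

section Left

open Preadditive.RightFreyd ZeroObject

variable {A : Type u} [Category.{v} A] [Preadditive A] [HasZeroObject A]

/-- An object of `A` becomes an arrow with zero source, so a homotopy into it is zero: a square into
it vanishes only if its right component does. -/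
lemma mono_functor_map {X Y : A} (f : X ⟶ Y) [Mono f] : Mono ((functor A).map f) := by
  rw [Preadditive.mono_iff_cancel_zero]
  intro w g hg
  obtain ⟨w, rfl⟩ : ∃ a, w = (quotient A).obj a := ⟨w.as, rfl⟩
  obtain ⟨g, rfl⟩ := (quotient A).map_surjective g
  replace hg := ((quotient A).map_comp _ _).trans hg
  rw [quotient_map_eq_zero_iff] at hg ⊢
  obtain ⟨h, hh⟩ := hg
  let g' : w.right ⟶ X := g.right
  have hg : g' ≫ f = 0 := (sub_zero _).symm.trans (hh.trans comp_zero)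
  have hg' : g' = 0 := zero_of_comp_mono f hg
  exact ⟨⟨h, (sub_zero _).trans (hg'.trans comp_zero.symm)⟩⟩

lemma functor_preservesKernel {X Y : A} (f : X ⟶ Y) :
    PreservesLimit (parallelPair f 0) (functor A) where
  preserves {c} hc := by
    have : Mono (Fork.ι c) := Fork.IsLimit.mono hc
    have := mono_functor_map (Fork.ι c)
    refine ⟨(KernelFork.isLimitMapConeEquiv c (functor A)).symm
      (KernelFork.IsLimit.ofι' _ (by
        rw [← Functor.map_comp, KernelFork.condition, Functor.map_zero])
        fun {w} g hg => Nonempty.some ?_)⟩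
    obtain ⟨w, rfl⟩ : ∃ a, w = (quotient A).obj a := ⟨w.as, rfl⟩
    obtain ⟨g, rfl⟩ := (quotient A).map_surjective g
    replace hg := ((quotient A).map_comp _ _).trans hg
    rw [quotient_map_eq_zero_iff] at hg
    obtain ⟨h, hh⟩ := hg
    have hg' : g.right ≫ f = 0 := (sub_zero _).symm.trans (hh.trans comp_zero)
    obtain ⟨l, hl⟩ := KernelFork.IsLimit.lift' hc g.right hg'
    -- The lift `l` kills the relations `w.hom`, so it defines a morphism on the cokernel of `w.hom`
    -- through a square with zero left component.
    have hw : w.hom ≫ l = 0 := by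
      rw [← cancel_mono (Fork.ι c), Category.assoc, hl, zero_comp]
      exact g.w.symm.trans comp_zero
    refine ⟨⟨(quotient A).map (Arrow.homMk 0 l (zero_comp.trans hw.symm)), ?_⟩⟩
    refine ((quotient A).map_comp _ _).symm.trans (congrArg _ (Arrow.hom_ext _ _ ?_ ?_))
    · exact (isZero_zero A).eq_of_tgt _ _
    · exact hl

instance (A : Type u) [Category.{v} A] [Preadditive A] [HasPullbacks A] [HasFiniteBiproducts A] :
    PreservesFiniteLimits (functor A) := by
  have := hasBinaryBiproducts_of_finite_biproducts A
  have : HasFiniteProducts A := inferInstance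
  have : HasEqualizers A := hasEqualizers_of_hasPullbacks_and_binary_products
  have : HasZeroObject (Mod A) := hasZeroObject_of_hasFiniteBiproducts _
  have := @functor_preservesKernel A _ _ _
  exact Functor.preservesFiniteLimits_of_preservesKernels _

end Left

/-! ### From presentations to finite colimits. -/

section RightExact

open Preadditive.RightFreyd ZeroObject

variable {A : Type u} [Category.{v} A] [Preadditive A] [HasFiniteBiproducts A]
  {B : Type u'} [Category.{v'} B] [Preadditive B]

lemma PreservesPresentations.preservesFiniteColimits {G : Mod A ⥤ B}
    (hG : PreservesPresentations G) [G.Additive] [HasZeroObject B] :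
    PreservesFiniteColimits G := by
  have := hasBinaryBiproducts_of_finite_biproducts A
  have : HasFiniteCoproducts (Mod A) := inferInstance
  have : HasBinaryBiproducts (Mod A) := hasBinaryBiproducts_of_finite_biproducts _
  have : HasCoequalizers (Mod A) := Preadditive.hasCoequalizers_of_hasCokernels
  have : HasZeroObject (Mod A) := hasZeroObject_of_hasFiniteBiproducts _
  have := @PreservesPresentations.preservesCokernel _ _ _ _ _ _ _ _ hG
  exact Functor.preservesFiniteColimits_of_preservesCokernels _

end RightExact

/-! ### Induced functors on `mod(A)` and their uniqueness. -/

section FunctorOnMod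

open Preadditive.RightFreyd ZeroObject

variable {A : Type u} [Category.{v} A] [Preadditive A] [HasZeroObject A]
  {B : Type u'} [Category.{v'} B] [Preadditive B]

/-- The functor `modMap F` extends `F`. -/
def functorCompModMapIso [HasZeroObject B] (F : A ⥤ B) [F.Additive] :
    functor A ⋙ modMap F ≅ F ⋙ functor B :=
  NatIso.ofComponents (fun X => (quotient B).mapIso
    (Arrow.isoMk (f := F.mapArrow.obj ((rightFunctor A).obj X))
      (g := (rightFunctor B).obj (F.obj X)) F.mapZeroObject (Iso.refl (F.obj X))
      ((F.map_isZero (isZero_zero A)).eq_of_src _ _))) (fun {X Y} f => by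
    refine ((quotient B).map_comp (F.mapArrow.map ((rightFunctor A).map f)) _).symm.trans
      (Eq.trans ?_ ((quotient B).map_comp _ _))
    refine congrArg _ (Arrow.hom_ext _ _ ?_ ?_)
    · exact (isZero_zero B).eq_of_tgt _ _
    · exact (Category.comp_id _).trans (Category.id_comp _).symm)

lemma modMap_map_modπ [HasZeroObject B] (F : A ⥤ B) [F.Additive] (a : Arrow A) :
    (modMap F).map (modπ a) =
      (functorCompModMapIso F).hom.app a.right ≫ modπ (F.mapArrow.obj a) := by
  refine Eq.trans ?_ ((quotient B).map_comp _ _)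
  refine (modMap_map_quotient F _).trans (congrArg _ (Arrow.hom_ext _ _ ?_ ?_))
  · exact (F.map_isZero (isZero_zero A)).eq_of_src _ _
  · exact (F.map_id _).trans (Category.id_comp _).symm

/-- Up to `functorCompModMapIso`, the presentation of `a` is carried to the presentation of `F(a)`;
no exactness of `F` is involved. -/
lemma modMap_preservesPresentations [HasZeroObject B] (F : A ⥤ B) [F.Additive] :
    PreservesPresentations (modMap F) where
  epi a := by
    rw [modMap_map_modπ]
    have := epi_modπ (F.mapArrow.obj a)
    exact epi_comp' inferInstance this
  exists_desc a Z k hk := by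
    obtain ⟨l, hl⟩ := exists_modπ_desc (F.mapArrow.obj a)
      ((functorCompModMapIso F).inv.app a.right ≫ k) (by
        refine ((functorCompModMapIso F).inv.naturality_assoc a.hom k).trans ?_
        exact (congrArg (_ ≫ ·) hk).trans comp_zero)
    refine ⟨l, ?_⟩
    rw [modMap_map_modπ]
    refine (Category.assoc _ _ _).trans ((congrArg (_ ≫ ·) hl).trans ?_)
    exact (functorCompModMapIso F).hom_inv_id_app_assoc a.right k

section Lift

variable [HasCokernels B]

/-- The functor which sends an arrow `a` to the cokernel of `F(a)`. -/
def arrowCokernel (F : A ⥤ B) : Arrow A ⥤ B where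
  obj a := cokernel (F.map a.hom)
  map {a b} f := cokernel.map _ _ (F.map f.left) (F.map f.right) (by
    rw [← F.map_comp, ← F.map_comp]
    exact congrArg F.map f.w.symm)
  map_id a := by
    apply coequalizer.hom_ext
    refine (cokernel.π_desc _ _ _).trans ?_
    refine (congrArg (· ≫ _) (F.map_id _)).trans ?_
    rw [Category.id_comp, Category.comp_id]
  map_comp f g := by
    apply coequalizer.hom_ext
    refine (cokernel.π_desc _ _ _).trans ?_
    refine (congrArg (· ≫ _) (F.map_comp _ _)).trans ?_
    refine Eq.trans ?_ (cokernel.π_desc_assoc _ _ _ _).symm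
    rw [Category.assoc, Category.assoc]
    exact congrArg (_ ≫ ·) (cokernel.π_desc _ _ _).symm

omit [Preadditive A] [HasZeroObject A] in
lemma π_arrowCokernel_map (F : A ⥤ B) {a b : Arrow A} (f : a ⟶ b) :
    cokernel.π (F.map a.hom) ≫ (arrowCokernel F).map f = F.map f.right ≫ cokernel.π (F.map b.hom) :=
  cokernel.π_desc _ _ _

/-- The functor `mod(A) ⥤ B` which extends an additive functor `A ⥤ B`
to a category with cokernels. -/
def modLift (F : A ⥤ B) [F.Additive] : Mod A ⥤ B :=
  CategoryTheory.Quotient.lift _ (arrowCokernel F) (by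
    rintro a b f g ⟨h⟩
    apply coequalizer.hom_ext
    refine (π_arrowCokernel_map F f).trans (Eq.trans ?_ (π_arrowCokernel_map F g).symm)
    -- Homotopic squares have right components differing by a morphism through `b.hom`, whose image
    -- the cokernel projection kills.
    refine sub_eq_zero.1 ((Preadditive.sub_comp _ _ _).symm.trans ?_)
    rw [← F.map_sub, h.comm, F.map_comp, Category.assoc, cokernel.condition, comp_zero]
    rfl)

omit [HasZeroObject A] in
lemma π_modLift_map (F : A ⥤ B) [F.Additive] {a b : Arrow A} (f : a ⟶ b) :
    cokernel.π (F.map a.hom) ≫ (modLift F).map ((quotient A).map f) =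
      F.map f.right ≫ cokernel.π (F.map b.hom) :=
  π_arrowCokernel_map F f

instance (F : A ⥤ B) [F.Additive] : (modLift F).Additive where
  map_add {X Y f g} := by
    obtain ⟨a, rfl⟩ : ∃ a, X = (quotient A).obj a := ⟨X.as, rfl⟩
    obtain ⟨b, rfl⟩ : ∃ a, Y = (quotient A).obj a := ⟨Y.as, rfl⟩
    obtain ⟨f, rfl⟩ := (quotient A).map_surjective f
    obtain ⟨g, rfl⟩ := (quotient A).map_surjective g
    rw [← Functor.map_add]
    apply coequalizer.hom_ext
    refine (π_modLift_map F (f + g)).trans ?_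
    refine Eq.trans ?_ (Preadditive.comp_add _ _ _ _ _ _).symm
    refine Eq.trans ?_ (congrArg₂ (· + ·) (π_modLift_map F f) (π_modLift_map F g)).symm
    exact (congrArg (· ≫ _) F.map_add).trans (Preadditive.add_comp _ _ _ _ _ _)

/-- The functor `modLift F` extends `F`. -/
def modLiftIso (F : A ⥤ B) [F.Additive] : functor A ⋙ modLift F ≅ F :=
  NatIso.ofComponents (fun X =>
    { hom := cokernel.desc (F.map (0 : (0 : A) ⟶ X)) (𝟙 (F.obj X))
        ((F.map_isZero (isZero_zero A)).eq_of_src _ _)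
      inv := cokernel.π (F.map (0 : (0 : A) ⟶ X))
      hom_inv_id := by
        apply coequalizer.hom_ext
        refine (cokernel.π_desc_assoc _ _ _ _).trans ?_
        exact (Category.id_comp _).trans (Category.comp_id _).symm
      inv_hom_id := cokernel.π_desc _ _ _ }) (fun {X Y} f => by
    refine coequalizer.hom_ext (f := F.map (0 : (0 : A) ⟶ X)) (g := 0) ?_
    refine ((Category.assoc _ _ _).symm.trans
      (congrArg (· ≫ _) (π_modLift_map F ((rightFunctor A).map f)))).trans ?_
    refine (Category.assoc _ _ _).trans ((congrArg (_ ≫ ·)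
      (cokernel.π_desc (F.map (0 : (0 : A) ⟶ Y)) _ _)).trans ?_)
    refine Eq.trans ?_ (cokernel.π_desc_assoc (F.map (0 : (0 : A) ⟶ X)) _ _ _).symm
    exact (Category.comp_id _).trans (Category.id_comp _).symm)

lemma modLift_map_modπ (F : A ⥤ B) [F.Additive] (a : Arrow A) :
    (modLift F).map (modπ a) = (modLiftIso F).hom.app a.right ≫ cokernel.π (F.map a.hom) := by
  apply coequalizer.hom_ext
  refine (π_modLift_map F _).trans ?_
  refine Eq.trans ?_ (cokernel.π_desc_assoc _ _ _ _).symm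
  exact congrArg (· ≫ _) (F.map_id _)

lemma modLift_preservesPresentations (F : A ⥤ B) [F.Additive] :
    PreservesPresentations (modLift F) where
  epi a := by
    rw [modLift_map_modπ]
    exact epi_comp ((modLiftIso F).hom.app a.right) (cokernel.π (F.map a.hom))
  exists_desc a Z k hk := by
    refine ⟨cokernel.desc (F.map a.hom) ((modLiftIso F).inv.app a.right ≫ k) ?_, ?_⟩
    · refine ((modLiftIso F).inv.naturality_assoc a.hom k).trans ?_
      exact (congrArg (_ ≫ ·) hk).trans comp_zero
    · rw [modLift_map_modπ]
      refine (Category.assoc _ _ _).trans ((congrArg (_ ≫ ·) (cokernel.π_desc _ _ _)).trans ?_)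
      exact (modLiftIso F).hom_inv_id_app_assoc a.right k

end Lift

section Ext

variable {F G H : Mod A ⥤ B} [G.Additive] [H.Additive]

/-- By naturality of `α` at the presenting arrow, the right-hand side kills that arrow and so
descends to `F.obj X`. The extension is unique since `F.map (modπ X.as)` is epi. -/
lemma PreservesPresentations.exists_extension (hF : PreservesPresentations F)
    (α : functor A ⋙ F ⟶ functor A ⋙ G) (X : Mod A) :
    ∃ l : F.obj X ⟶ G.obj X, F.map (modπ X.as) ≫ l = α.app X.as.right ≫ G.map (modπ X.as) :=
  hF.exists_desc X.as _ (by
    refine (α.naturality_assoc X.as.hom _).trans ?_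
    exact (congrArg (_ ≫ ·) (map_functor_map_modπ G X.as)).trans comp_zero)

/-- The natural transformation between functors on `mod(A)` which extends one
between the restrictions to `A`. -/
def modExtHom (hF : PreservesPresentations F) (α : functor A ⋙ F ⟶ functor A ⋙ G) : F ⟶ G where
  app X := (hF.exists_extension α X).choose
  naturality X Y f := by
    obtain ⟨a, rfl⟩ : ∃ a, X = (quotient A).obj a := ⟨X.as, rfl⟩
    obtain ⟨b, rfl⟩ : ∃ a, Y = (quotient A).obj a := ⟨Y.as, rfl⟩
    obtain ⟨f, rfl⟩ := (quotient A).map_surjective f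
    have ha : F.map (modπ a) ≫ (hF.exists_extension α ((quotient A).obj a)).choose =
      α.app a.right ≫ G.map (modπ a) := (hF.exists_extension α ((quotient A).obj a)).choose_spec
    have hb : F.map (modπ b) ≫ (hF.exists_extension α ((quotient A).obj b)).choose =
      α.app b.right ≫ G.map (modπ b) := (hF.exists_extension α ((quotient A).obj b)).choose_spec
    have := hF.epi a
    have hα : F.map ((functor A).map f.right) ≫ α.app b.right =
      α.app a.right ≫ G.map ((functor A).map f.right) := α.naturality f.right
    rw [← cancel_epi (F.map (modπ a)), ← F.map_comp_assoc, ← modπ_naturality, F.map_comp,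
      Category.assoc, hb, ← Category.assoc, hα, ← Category.assoc, ha, Category.assoc, Category.assoc,
      ← G.map_comp, ← G.map_comp, modπ_naturality]

lemma map_modπ_modExtHom_app (hF : PreservesPresentations F)
    (α : functor A ⋙ F ⟶ functor A ⋙ G) (X : Mod A) :
    F.map (modπ X.as) ≫ (modExtHom hF α).app X = α.app X.as.right ≫ G.map (modπ X.as) :=
  (hF.exists_extension α X).choose_spec

lemma modExtHom_comp (hF : PreservesPresentations F) (hG : PreservesPresentations G)
    (α : functor A ⋙ F ⟶ functor A ⋙ G) (β : functor A ⋙ G ⟶ functor A ⋙ H) :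
    modExtHom hF α ≫ modExtHom hG β = modExtHom hF (α ≫ β) := by
  ext X
  have := hF.epi X.as
  refine (cancel_epi (F.map (modπ X.as))).1 ?_
  refine Eq.trans ?_ (map_modπ_modExtHom_app hF (α ≫ β) X).symm
  refine (Category.assoc _ _ _).symm.trans ?_
  refine (congrArg (· ≫ _) (map_modπ_modExtHom_app hF α X)).trans ?_
  refine (Category.assoc _ _ _).trans ?_
  refine (congrArg (_ ≫ ·) (map_modπ_modExtHom_app hG β X)).trans ?_
  exact (Category.assoc _ _ _).symm

lemma modExtHom_id (hG : PreservesPresentations G) : modExtHom hG (𝟙 (functor A ⋙ G)) = 𝟙 G := by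
  ext X
  have := hG.epi X.as
  refine (cancel_epi (G.map (modπ X.as))).1 ?_
  refine (map_modπ_modExtHom_app hG _ X).trans ?_
  exact (Category.id_comp _).trans (Category.comp_id _).symm

/-- Two presentation preserving additive functors on `mod(A)` are isomorphic if their
restrictions to `A` are. -/
def modExt (hG : PreservesPresentations G) (hH : PreservesPresentations H)
    (α : functor A ⋙ G ≅ functor A ⋙ H) : G ≅ H where
  hom := modExtHom hG α.hom
  inv := modExtHom hH α.inv
  hom_inv_id := by rw [modExtHom_comp, α.hom_inv_id, modExtHom_id]
  inv_hom_id := by rw [modExtHom_comp, α.inv_hom_id, modExtHom_id]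

end Ext

end FunctorOnMod

/-! ### Exactness of functors on `mod(A)`. -/

section Exact

open Preadditive.RightFreyd ZeroObject

variable {A : Type u} [Category.{v} A] [Preadditive A] [HasFiniteBiproducts A] [HasPullbacks A]
  {B : Type u'} [Category.{v'} B] [Abelian B]

omit [HasPullbacks A] in
-- The form of right exactness used in diagram chases: a generalised element dying in the cokernel
-- comes from a relation after an epimorphic refinement.
lemma PreservesPresentations.exists_lift {G : Mod A ⥤ B} (hG : PreservesPresentations G)
    [G.Additive] (a : Arrow A) {T : B} (x : T ⟶ G.obj ((functor A).obj a.right))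
    (hx : x ≫ G.map (modπ a) = 0) :
    ∃ (T' : B) (p : T' ⟶ T) (_ : Epi p) (y : T' ⟶ G.obj ((functor A).obj a.left)),
      p ≫ x = y ≫ G.map ((functor A).map a.hom) := by
  have := hG.epi a
  have h := ShortComplex.exact_of_g_is_cokernel
    (ShortComplex.mk _ _ (map_functor_map_modπ G a)) (CokernelCofork.IsColimit.ofπ' _ _
      (fun k hk => ⟨(hG.exists_desc a k hk).choose, (hG.exists_desc a k hk).choose_spec⟩))
  exact (ShortComplex.exact_iff_exact_up_to_refinements _).1 h x hx

lemma PreservesPresentations.preservesMonomorphisms {G : Mod A ⥤ B}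
    (hG : PreservesPresentations G) [G.Additive] [PreservesFiniteLimits (functor A ⋙ G)]
    {X Y : Mod A} (f : X ⟶ Y) [hf : Mono f] : Mono (G.map f) := by
  obtain ⟨a, rfl⟩ : ∃ a, X = (quotient A).obj a := ⟨X.as, rfl⟩
  obtain ⟨b, rfl⟩ : ∃ a, Y = (quotient A).obj a := ⟨Y.as, rfl⟩
  obtain ⟨f, rfl⟩ := (quotient A).map_surjective f
  -- Since `f` is mono, its kernel inclusion is null-homotopic, so the pullback projection to
  -- `a.right` factors through `a.hom`.
  have h0 : (quotient A).map (kerι f) = 0 := by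
    rw [← cancel_mono ((quotient A).map f), kerι_comp, zero_comp]
  rw [quotient_map_eq_zero_iff] at h0
  obtain ⟨h, hh⟩ : ∃ h : pullback f.right b.hom ⟶ a.left,
      pullback.fst f.right b.hom = h ≫ a.hom :=
    ⟨h0.some.hom, (sub_zero _).symm.trans h0.some.comm⟩
  have := hG.epi a
  rw [Preadditive.mono_iff_cancel_zero]
  intro T x hx
  obtain ⟨T₁, p₁, _, y, hy⟩ := surjective_up_to_refinements_of_epi (G.map (modπ a)) x
  obtain ⟨T₂, p₂, _, z, hz⟩ := hG.exists_lift b (y ≫ G.map ((functor A).map f.right)) (by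
    rw [Category.assoc, ← G.map_comp, modπ_naturality, G.map_comp, ← reassoc_of% hy, hx, comp_zero])
  -- Left exactness on `A` keeps this a pullback in `B`. The refined representative `y` of `x`
  -- therefore lifts to it, and so factors through `G(a.hom)` and dies in `G(a)`.
  have hP := (IsPullback.of_hasPullback f.right b.hom).map (functor A ⋙ G)
  let l := hP.lift (p₂ ≫ y) z (by rw [Category.assoc]; exact hz)
  have hl : p₂ ≫ y = l ≫ G.map ((functor A).map h) ≫ G.map ((functor A).map a.hom) := by
    rw [← G.map_comp, ← Functor.map_comp, ← hh]
    exact (hP.lift_fst _ _ _).symm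
  rw [← cancel_epi p₁, hy, comp_zero, ← cancel_epi p₂, comp_zero, ← Category.assoc, hl,
    Category.assoc, Category.assoc, map_functor_map_modπ, comp_zero, comp_zero]

lemma PreservesPresentations.preservesFiniteLimits {G : Mod A ⥤ B}
    (hG : PreservesPresentations G) [G.Additive] [PreservesFiniteLimits (functor A ⋙ G)] :
    PreservesFiniteLimits G := by
  have := hG.preservesFiniteColimits
  have : G.PreservesMonomorphisms := ⟨fun f _ => hG.preservesMonomorphisms f⟩
  have := Functor.preservesHomology_of_preservesMonos_and_cokernels G
  exact Functor.preservesFiniteLimits_of_preservesHomology G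

end Exact

/-! ### The universal property of `Ab(A)`. -/

section AbHullFunctors

open Preadditive.RightFreyd

variable {A : Type u} [Category.{v} A] [Preadditive A] [HasFiniteBiproducts A]

lemma additive_of_preservesFiniteColimits {C : Type u} [Category.{v} C] [Preadditive C]
    [HasFiniteBiproducts C] {B : Type u'} [Category.{v'} B] [Preadditive B] (F : C ⥤ B)
    [HasZeroObject B] [PreservesFiniteColimits F] : F.Additive := by
  have : HasZeroObject C := hasZeroObject_of_hasFiniteBiproducts _
  have : F.PreservesZeroMorphisms := Functor.preservesZeroMorphisms_of_map_zero_object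
    ((F.mapIso (HasZeroObject.zeroIsoInitial)) ≪≫ PreservesInitial.iso F ≪≫
      HasZeroObject.zeroIsoInitial.symm)
  have := hasBinaryBiproducts_of_finite_biproducts C
  have := preservesBinaryBiproducts_of_preservesBinaryCoproducts F
  exact Functor.additive_of_preservesBinaryBiproducts F

/-- This links the two layers: the opposite of the right exact inner functor is the left exact input
that makes the outer functor exact. -/
lemma preservesFiniteLimits_op_of_preservesPresentations
    {B : Type u'} [Category.{v'} B] [Preadditive B] [HasZeroObject B] {G : Mod A ⥤ B} [G.Additive]
    (hG : PreservesPresentations G) : PreservesFiniteLimits G.op := by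
  have := hG.preservesFiniteColimits
  exact preservesFiniteLimits_op G

/-- The functor `modMap F` is exact if `F` is left exact. -/
lemma modMap_exact {B : Type u'} [Category.{v'} B] [Preadditive B] [HasFiniteBiproducts B]
    [HasPullbacks A] [HasPullbacks B] (F : A ⥤ B) [F.Additive] [PreservesFiniteLimits F] :
    PreservesFiniteLimits (modMap F) ∧ PreservesFiniteColimits (modMap F) := by
  have : PreservesFiniteLimits (F ⋙ functor B) := comp_preservesFiniteLimits _ _
  have : PreservesFiniteLimits (functor A ⋙ modMap F) :=
    preservesFiniteLimits_of_natIso (functorCompModMapIso F).symm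
  have h := modMap_preservesPresentations F
  exact ⟨h.preservesFiniteLimits, h.preservesFiniteColimits⟩

/-- The functor `modLift F` is exact if `F` is left exact. -/
lemma modLift_exact {B : Type u'} [Category.{v'} B] [Abelian B]
    [HasPullbacks A] (F : A ⥤ B) [F.Additive] [PreservesFiniteLimits F] :
    PreservesFiniteLimits (modLift F) ∧ PreservesFiniteColimits (modLift F) := by
  have : PreservesFiniteLimits (functor A ⋙ modLift F) :=
    preservesFiniteLimits_of_natIso (modLiftIso F).symm
  have h := modLift_preservesPresentations F
  exact ⟨h.preservesFiniteLimits, h.preservesFiniteColimits⟩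

/-- The functor `Ab(A) ⥤ Ab(B)` induced by an additive functor is exact. -/
lemma abHullMap_exact {B : Type u'} [Category.{v'} B] [Preadditive B] [HasFiniteBiproducts B]
    (F : A ⥤ B) [F.Additive] : exactFunctor _ _ (abHullMap F) := by
  have : HasZeroObject (Mod B) := hasZeroObject_of_hasFiniteBiproducts _
  have := preservesFiniteLimits_op_of_preservesPresentations (modMap_preservesPresentations F)
  obtain ⟨_, _⟩ := modMap_exact (modMap F).op
  exact ⟨preservesFiniteLimits_op _, preservesFiniteColimits_op _⟩

/-- The functor `abHullMap F` extends `F`. -/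
def toAbHullCompMapIso {B : Type u'} [Category.{v'} B] [Preadditive B] [HasFiniteBiproducts B]
    (F : A ⥤ B) [F.Additive] : toAbHull A ⋙ abHullMap F ≅ F ⋙ toAbHull B := by
  have : HasZeroObject (Mod B) := hasZeroObject_of_hasFiniteBiproducts _
  let e : (functor (Mod A)ᵒᵖ).rightOp ⋙ (modMap (modMap F).op).op ≅
      modMap F ⋙ (functor (Mod B)ᵒᵖ).rightOp :=
    NatIso.ofComponents (fun X => ((functorCompModMapIso (modMap F).op).app (.op X)).op.symm)
      (fun {X Y} f => Quiver.Hom.unop_inj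
        ((functorCompModMapIso (modMap F).op).inv.naturality f.op).symm)
  exact Functor.isoWhiskerLeft (functor A) e ≪≫
    Functor.isoWhiskerRight (functorCompModMapIso F) (functor (Mod B)ᵒᵖ).rightOp

variable {B : Type u'} [Category.{v'} B] [Abelian B]

/-- The functor `Ab(A) ⥤ B` which extends an additive functor from `A` to an abelian category. -/
def abHullLift (F : A ⥤ B) [F.Additive] : AbHull A ⥤ B :=
  (modLift (modLift F).op).leftOp

lemma abHullLift_exact (F : A ⥤ B) [F.Additive] : exactFunctor _ _ (abHullLift F) := by
  have := preservesFiniteLimits_op_of_preservesPresentations (modLift_preservesPresentations F)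
  obtain ⟨_, _⟩ := modLift_exact (modLift F).op
  exact ⟨preservesFiniteLimits_leftOp _, preservesFiniteColimits_leftOp _⟩

/-- The functor `abHullLift F` extends `F`. -/
def abHullLiftIso (F : A ⥤ B) [F.Additive] : toAbHull A ⋙ abHullLift F ≅ F := by
  let e : (functor (Mod A)ᵒᵖ).rightOp ⋙ (modLift (modLift F).op).leftOp ≅ modLift F :=
    NatIso.ofComponents (fun X => ((modLiftIso (modLift F).op).app (.op X)).unop.symm)
      (fun {X Y} f => Quiver.Hom.op_inj ((modLiftIso (modLift F).op).inv.naturality f.op).symm)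
  exact Functor.isoWhiskerLeft (functor A) e ≪≫ modLiftIso F

/-- Two exact functors on `Ab(A)` are isomorphic if their restrictions to `A` are. -/
def abHullExt {F G : AbHull A ⥤ B} (hF : exactFunctor _ _ F) (hG : exactFunctor _ _ G)
    (α : toAbHull A ⋙ F ≅ toAbHull A ⋙ G) : F ≅ G := by
  -- The embedding of `(Mod A)ᵒᵖ` is left exact, so its `rightOp` is right exact; hence exact
  -- functors on `Ab(A)` restrict to right exact functors on `mod(A)`.
  have h₁ (F : AbHull A ⥤ B) (hF : exactFunctor _ _ F) :
      PreservesFiniteColimits ((functor (Mod A)ᵒᵖ).rightOp ⋙ F) := by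
    have := ((exactFunctor_iff F).1 hF).2
    have := preservesFiniteColimits_rightOp (functor (Mod A)ᵒᵖ)
    exact comp_preservesFiniteColimits _ _
  have h₂ (F : AbHull A ⥤ B) (hF : exactFunctor _ _ F) : PreservesFiniteColimits F.rightOp := by
    have := ((exactFunctor_iff F).1 hF).1
    exact preservesFiniteColimits_rightOp F
  have := h₁ F hF
  have := h₁ G hG
  have := h₂ F hF
  have := h₂ G hG
  have := additive_of_preservesFiniteColimits ((functor (Mod A)ᵒᵖ).rightOp ⋙ F)
  have := additive_of_preservesFiniteColimits ((functor (Mod A)ᵒᵖ).rightOp ⋙ G)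
  have := additive_of_preservesFiniteColimits F.rightOp
  have := additive_of_preservesFiniteColimits G.rightOp
  -- Uniqueness is applied once per layer, from `A` to `mod(A)` and then from `mod(A)ᵒᵖ` to its own
  -- `mod`; passing to opposites swaps `F` and `G`.
  let β : (functor (Mod A)ᵒᵖ).rightOp ⋙ F ≅ (functor (Mod A)ᵒᵖ).rightOp ⋙ G :=
    modExt (.of_preservesCokernels _) (.of_preservesCokernels _) α
  let γ : G.rightOp ≅ F.rightOp :=
    modExt (.of_preservesCokernels _) (.of_preservesCokernels _) (NatIso.op β)
  exact NatIso.ofComponents (fun X => (γ.app X.unop).unop)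
    (fun {X Y} f => Quiver.Hom.op_inj (γ.hom.naturality f.unop).symm)

end AbHullFunctors

/-! ### The universal property of `Ab(add(C))`. -/

section Universal

attribute [local instance] Abelian.hasFiniteBiproducts

variable {C : Type u} [Category.{v} C]

/-- The functor `abAddMap L` extends `L`. -/
def toAbAddCompMapIso {D : Type u'} [Category.{v'} D] (L : C ⥤ D) :
    toAbAdd C ⋙ abAddMap L ≅ L ⋙ toAbAdd D :=
  Functor.isoWhiskerLeft (toAddHull C) (toAbHullCompMapIso (addHullMap L)) ≪≫
    Functor.isoWhiskerRight (toAddHullCompMapIso L) (toAbHull (AddHull D))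

lemma abAddMap_exact {D : Type u'} [Category.{v'} D] (L : C ⥤ D) :
    exactFunctor _ _ (abAddMap L) :=
  abHullMap_exact (addHullMap L)

variable {B : Type u'} [Category.{v'} B] [Abelian B]

/-- The exact functor `Ab(add(C)) ⥤ B` which extends a functor from `C` to an abelian category. -/
def abAddLift (F : C ⥤ B) : AbHull (AddHull C) ⥤ B := abHullLift (addHullLift F)

lemma abAddLift_exact (F : C ⥤ B) : exactFunctor _ _ (abAddLift F) := abHullLift_exact _

/-- The functor `abAddLift F` extends `F`. -/
def abAddLiftIso (F : C ⥤ B) : toAbAdd C ⋙ abAddLift F ≅ F :=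
  Functor.isoWhiskerLeft (toAddHull C) (abHullLiftIso (addHullLift F)) ≪≫ addHullLiftIso F

instance (A : Type u) [Category.{v} A] [Preadditive A] [HasFiniteBiproducts A] :
    (toAbHull A).Additive where
  map_add {X Y f g} := by
    refine (congrArg (Preadditive.RightFreyd.functor (Mod A)ᵒᵖ).rightOp.map
      (Functor.map_add (F := Preadditive.RightFreyd.functor A))).trans ?_
    exact congrArg Quiver.Hom.op
      (Functor.map_add (F := Preadditive.RightFreyd.functor (Mod A)ᵒᵖ))

lemma additive_of_exact {A : Type u} [Category.{v} A] [Abelian A] {F : A ⥤ B}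
    (hF : exactFunctor _ _ F) : F.Additive := by
  have := ((exactFunctor_iff F).1 hF).2
  exact additive_of_preservesFiniteColimits F

/-- Two exact functors on `Ab(add(C))` are isomorphic if their restrictions to `C` are. -/
def abAddExt {F G : AbHull (AddHull C) ⥤ B} (hF : exactFunctor _ _ F) (hG : exactFunctor _ _ G)
    (α : toAbAdd C ⋙ F ≅ toAbAdd C ⋙ G) : F ≅ G := by
  have := additive_of_exact hF
  have := additive_of_exact hG
  exact abHullExt hF hG (addHullExt α)

lemma exactFunctor_id {A : Type*} [Category* A] : exactFunctor A A (𝟭 A) :=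
  (exactFunctor_iff _).2 ⟨inferInstance, inferInstance⟩

lemma exactFunctor_comp {A : Type*} [Category* A] {A' : Type*} [Category* A'] {A'' : Type*}
    [Category* A''] {F : A ⥤ A'} {G : A' ⥤ A''} (hF : exactFunctor _ _ F)
    (hG : exactFunctor _ _ G) : exactFunctor _ _ (F ⋙ G) := by
  obtain ⟨_, _⟩ := (exactFunctor_iff F).1 hF
  obtain ⟨_, _⟩ := (exactFunctor_iff G).1 hG
  exact ⟨comp_preservesFiniteLimits F G, comp_preservesFiniteColimits F G⟩

end Universal

/-! ### Serre subcategories and inverted morphisms. -/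

section Serre

variable {C : Type u} [Category.{v} C] {A : Type u'} [Category.{v'} A] [Abelian A]

/-- The kernel of an exact functor is a Serre class, so only the generators matter; `G` sends them
to kernels and cokernels of isomorphisms. -/
lemma serreClosure_kerCoker_le_kernel {F : C ⥤ A} {W : MorphismProperty C} {B : Type*} [Category* B]
    [Abelian B] (G : A ⥤ B) (hG : exactFunctor _ _ G) (h : W.IsInvertedBy (F ⋙ G)) :
    serreClosure (KerCoker F W) ≤ G.kernel := by
  obtain ⟨_, _⟩ := (exactFunctor_iff G).1 hG
  have := additive_of_exact hG
  intro X hX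
  refine hX G.kernel (inferInstanceAs (ObjectProperty.IsSerreClass
    (ObjectProperty.inverseImage (IsZero (C := B)) G))) ?_
  rintro _ (⟨f, hf⟩ | ⟨f, hf⟩)
  · have : IsIso (G.map (F.map f)) := h f hf
    exact (isZero_kernel_of_mono _).of_iso (PreservesKernel.iso G (F.map f))
  · have : IsIso (G.map (F.map f)) := h f hf
    exact (isZero_cokernel_of_epi _).of_iso (PreservesCokernel.iso G (F.map f))

lemma isInvertedBy_comp_Q (F : C ⥤ A) (W : MorphismProperty C) (S : ObjectProperty A)
    [S.IsSerreClass] (h : KerCoker F W ≤ S) : W.IsInvertedBy (F ⋙ S.isoModSerre.Q) :=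
  fun _ _ f hf => Localization.inverts S.isoModSerre.Q S.isoModSerre (F.map f)
    ⟨h _ (.ker f hf), h _ (.coker f hf)⟩

lemma le_serreClosure (P : ObjectProperty A) : P ≤ serreClosure P :=
  fun X hX _ _ hQ => hQ X hX

end Serre

end KrauseHull

end

/-! ### The equivalence with the quotient category. -/

open KrauseHull ObjectProperty

/-- Let `L : C ⥤ D` be a localisation of `C` with respect to a class `W` of morphisms, so that `D`
is `C[W⁻¹]`. The induced functor `Ab(add(C)) ⥤ Ab(add(D))` is exact, extends `L`, inverts all
morphisms whose kernel and cokernel belong to the Serre subcategory `S` generated by the kernels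
and cokernels of the morphisms in `W`, and the functor `Ab(add(C))/S ⥤ Ab(add(D))` through which it
factors is an equivalence. -/
theorem mainTheorem2 {C : Type u} [Category.{v} C] {D : Type u'} [Category.{v'} D]
    (W : MorphismProperty C) (L : C ⥤ D) [L.IsLocalization W] :
    exactFunctor _ _ (KrauseHull.abAddMap L) ∧
    Nonempty (KrauseHull.toAbAdd C ⋙ KrauseHull.abAddMap L ≅ L ⋙ KrauseHull.toAbAdd D) ∧
    ∃ h : (KrauseHull.serreOf W).isoModSerre.IsInvertedBy (KrauseHull.abAddMap L),
      (Localization.Construction.lift (KrauseHull.abAddMap L) h :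
        KrauseHull.SerreQuotient (KrauseHull.serreOf W) ⥤
          KrauseHull.AbHull (KrauseHull.AddHull D)).IsEquivalence := by
  have hL := abAddMap_exact L
  refine ⟨hL, ⟨toAbAddCompMapIso L⟩, ?_⟩
  have hinv : (serreOf W).isoModSerre.IsInvertedBy (abAddMap L) := by
    obtain ⟨_, _⟩ := (exactFunctor_iff _).1 hL
    have := additive_of_exact hL
    rw [isoModSerre_isInvertedBy_iff]
    refine serreClosure_kerCoker_le_kernel _ hL ?_
    rw [MorphismProperty.IsInvertedBy.iff_of_iso W (toAbAddCompMapIso L)]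
    exact MorphismProperty.IsInvertedBy.of_comp _ _ (Localization.inverts L W) _
  refine ⟨hinv, ?_⟩
  let S := serreOf W
  let Q := S.isoModSerre.Q
  let : Abelian (SerreQuotient S) := SerreClassLocalization.abelian Q S
  have hQ : exactFunctor _ _ Q :=
    ⟨SerreClassLocalization.preservesFiniteLimits Q S,
      SerreClassLocalization.preservesFiniteColimits Q S⟩
  let E : SerreQuotient S ⥤ AbHull (AddHull D) := Localization.Construction.lift (abAddMap L) hinv
  let e₁ : Q ⋙ E ≅ abAddMap L := eqToIso (Localization.Construction.fac _ _)
  have hE : exactFunctor _ _ E := by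
    -- Exactness of a functor on the quotient can be tested after composing with `Q`.
    rw [← SerreClassLocalization.exactFunctor_comp_iff Q S]
    exact ObjectProperty.prop_of_iso _ e₁.symm hL
  have hW : W.IsInvertedBy (toAbAdd C ⋙ Q) := isInvertedBy_comp_Q _ W S (le_serreClosure _)
  -- As `toAbAdd C ⋙ Q` inverts `W`, it descends to `D`; its exact extension is the candidate
  -- inverse.
  let G : AbHull (AddHull D) ⥤ SerreQuotient S := abAddLift (Localization.lift _ hW L)
  have hG : exactFunctor _ _ G := abAddLift_exact _
  let e₂ : toAbAdd C ⋙ Q ≅ L ⋙ toAbAdd D ⋙ G :=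
    (Localization.fac _ hW L).symm ≪≫ Functor.isoWhiskerLeft L (abAddLiftIso _).symm
  let e₃ : abAddMap L ⋙ G ≅ Q := abAddExt (exactFunctor_comp hL hG) hQ
    (Functor.isoWhiskerRight (toAbAddCompMapIso L) G ≪≫ e₂.symm)
  -- Exact endofunctors of `Ab(add(D))` are compared on `D`, and functors on the localisation `D`
  -- are compared after precomposition with `L`.
  have e₄ : G ⋙ E ≅ 𝟭 _ := abAddExt (exactFunctor_comp hG hE) exactFunctor_id
    (Localization.liftNatIso L W (L ⋙ toAbAdd D ⋙ G ⋙ E) (L ⋙ toAbAdd D ⋙ 𝟭 _) _ _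
      (Functor.isoWhiskerRight e₂.symm E ≪≫ Functor.isoWhiskerLeft (toAbAdd C) e₁ ≪≫
        toAbAddCompMapIso L))
  -- The quotient is itself a localisation, so it suffices to compare after `Q`, where `e₃` applies.
  have e₅ : E ⋙ G ≅ 𝟭 _ := Localization.liftNatIso Q S.isoModSerre (Q ⋙ E ⋙ G) Q _ _
    (Functor.isoWhiskerRight e₁ G ≪≫ e₃)
  exact (CategoryTheory.Equivalence.mk E G e₅.symm e₄).isEquivalence_functor
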